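/- For an integer $n\ge 1$, attach to the unordered pairs $\{i,j\}$ of distinct elements of $\{1,\dots,n\}$ independent random variables $w_{i,j}$, uniform on $[0,1]$. For $t>0$ let $\mathcal G_n(t)$ be the graph on $\{1,\dots,n\}$ whose edges are the pairs with $w_{i,j}<t/n$ (an Erdős–Rényi graph with edge probability $\min(t/n,1)$), and let $L_n(t)$ be the largest order (number of vertices) of a connected component of $\mathcal G_n(t)$. For $t>1$ let $\rho(t)$ be the unique solution in $(0,1)$ of $1-x=e^{-tx}$, and set $X_n(t)=\frac{1}{\sqrt n}\,(L_n(t)-n\rho(t))$. Let $1<t_0<t_1$ and $0<\gamma<\frac12$. Then there exist constants $C>0$ and $C'>0$ (depending only on $t_0,t_1,\gamma$) such that, for every integer $n\ge1$ and every $t\in[t_0,t_1]$, \[\mathbb P\left(|X_n(t)|>n^{\gamma}\right)\le C'\exp\left(-C\,n^{2\gamma}\right).\] -/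

import Mathlib

open MeasureTheory

namespace RandomGraphFlow

/-- For `c > 1` the equation `1 - x = exp (-c x)` has exactly one solution in `(0, 1)`. -/
theorem existsUnique_survival {c : ℝ} (hc : 1 < c) :
    ∃! x : ℝ, x ∈ Set.Ioo (0 : ℝ) 1 ∧ 1 - x = Real.exp (-(c * x)) := by
  have hc0 : 0 < c := by linarith
  have hconv : StrictConvexOn ℝ Set.univ Real.exp := strictConvexOn_exp
  have huniq : ∀ x y : ℝ, 0 < x → x < y → 1 - x = Real.exp (-(c * x)) →
      1 - y = Real.exp (-(c * y)) → False := by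
    intro x y hx hxy h1 h2
    have hy : 0 < y := hx.trans hxy
    have hne : -(c * y) ≠ (0 : ℝ) := by
      have := mul_pos hc0 hy
      linarith
    have ha : 0 < x / y := div_pos hx hy
    have hb : 0 < 1 - x / y := by
      have : x / y < 1 := (div_lt_one hy).2 hxy
      linarith
    have h := hconv.2 (Set.mem_univ (-(c * y))) (Set.mem_univ (0 : ℝ)) hne ha hb (by ring)
    simp only [smul_eq_mul, mul_zero, add_zero, Real.exp_zero, mul_one] at h
    have e1 : x / y * -(c * y) = -(c * x) := by field_simp
    rw [e1, ← h1, ← h2] at h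
    have e2 : x / y * (1 - y) + (1 - x / y) = 1 - x := by field_simp; ring
    linarith
  have hex : ∃ x ∈ Set.Ioo (0 : ℝ) 1, 1 - x - Real.exp (-(c * x)) = 0 := by
    set a : ℝ := (c - 1) / (2 * c) with ha
    have ha0 : 0 < a := div_pos (by linarith) (by linarith)
    have ha1 : a < 1 := by rw [ha, div_lt_one (by linarith)]; linarith
    have hca : c * a = (c - 1) / 2 := by rw [ha]; field_simp
    have hfa : 0 < 1 - a - Real.exp (-(c * a)) := by
      have h1 : c * a + 1 ≤ Real.exp (c * a) := Real.add_one_le_exp _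
      have hpos : 0 < c * a + 1 := by rw [hca]; linarith
      have h2 : Real.exp (-(c * a)) ≤ (c * a + 1)⁻¹ := by
        rw [Real.exp_neg]
        exact inv_anti₀ hpos h1
      have h3 : (c * a + 1)⁻¹ < 1 - a := by
        rw [inv_lt_iff_one_lt_mul₀ hpos]
        have h4 : (1 - a) * (c * a + 1) = 1 + a * (c - 1 - c * a) := by ring
        rw [h4, hca]
        have : 0 < a * (c - 1 - (c - 1) / 2) := mul_pos ha0 (by linarith)
        linarith
      linarith
    have hf1 : 1 - (1 : ℝ) - Real.exp (-(c * 1)) < 0 := by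
      have := Real.exp_pos (-(c * 1))
      linarith
    have hcont : ContinuousOn (fun x : ℝ => 1 - x - Real.exp (-(c * x))) (Set.Icc a 1) := by
      fun_prop
    obtain ⟨x, hx, hx0⟩ := intermediate_value_Ioo' ha1.le hcont ⟨hf1, hfa⟩
    exact ⟨x, ⟨ha0.trans hx.1, hx.2⟩, hx0⟩
  obtain ⟨x, hx, hx0⟩ := hex
  refine ⟨x, ⟨hx, by linarith⟩, ?_⟩
  rintro y ⟨hy, hy0⟩
  rcases lt_trichotomy x y with h | h | h
  · exact (huniq x y hx.1 h (by linarith) hy0).elim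
  · exact h.symm
  · exact (huniq y x hy.1 h hy0 (by linarith)).elim

/-- `ρ(c)`: the solution in `(0, 1)` of `1 - x = exp (-c x)`, i.e. the survival probability of a
Galton-Watson tree with Poisson(`c`) offspring. For `c > 1` the set below has exactly one element,
see `rho_spec`. -/
noncomputable def rho (c : ℝ) : ℝ :=
  sSup {x : ℝ | x ∈ Set.Ioo (0 : ℝ) 1 ∧ 1 - x = Real.exp (-(c * x))}

theorem rho_spec {c : ℝ} (hc : 1 < c) :
    rho c ∈ Set.Ioo (0 : ℝ) 1 ∧ 1 - rho c = Real.exp (-(c * rho c)) := by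
  obtain ⟨x, hx, hu⟩ := existsUnique_survival hc
  have hs : {y : ℝ | y ∈ Set.Ioo (0 : ℝ) 1 ∧ 1 - y = Real.exp (-(c * y))} = {x} := by
    ext y
    exact ⟨fun h => hu y h, fun h => by rw [Set.mem_singleton_iff.1 h]; exact hx⟩
  have hr : rho c = x := by rw [rho, hs, csSup_singleton]
  rw [hr]
  exact hx

/-- The law of the weights: one weight for every unordered pair of elements of `Fin n`, all
independent and uniform on `[0, 1]`. The weights of the degenerate pairs `{i, i}` are never used. -/
noncomputable def weightLaw (n : ℕ) : Measure (Sym2 (Fin n) → ℝ) :=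
  Measure.pi fun _ => volume.restrict (Set.Icc (0 : ℝ) 1)

instance (n : ℕ) : IsProbabilityMeasure (weightLaw n) := by
  have : IsProbabilityMeasure (volume.restrict (Set.Icc (0 : ℝ) 1)) := ⟨by simp⟩
  unfold weightLaw
  infer_instance

/-- The graph process at time `t`: vertices `i ≠ j` are adjacent when the weight of the pair
`{i, j}` is smaller than `t / n`. -/
def graph (n : ℕ) (t : ℝ) (w : Sym2 (Fin n) → ℝ) : SimpleGraph (Fin n) :=
  SimpleGraph.fromEdgeSet {e | w e < t / n}

/-- The largest order (number of vertices) of a connected component of `G`. -/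
noncomputable def largestComponent {n : ℕ} (G : SimpleGraph (Fin n)) : ℕ :=
  Finset.univ.sup fun x : Fin n => (G.connectedComponentMk x).supp.ncard

/-- `L_n(t)`: the order of the largest component of the graph at time `t`. -/
noncomputable def L (n : ℕ) (t : ℝ) (w : Sym2 (Fin n) → ℝ) : ℕ :=
  largestComponent (graph n t w)

/-- `X_n(t) = (L_n(t) - n ρ(t)) / √n`. -/
noncomputable def X (n : ℕ) (t : ℝ) (w : Sym2 (Fin n) → ℝ) : ℝ :=
  1 / √(n : ℝ) * ((L n t w : ℝ) - n * rho t)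

end RandomGraphFlow

/-! Write `q = 1 - t/n`. For a set `M` of `m` vertices, the probability that the components meeting
`M` have `k` vertices in total is at most that of the value `k - m` under the binomial law with `n -
m` trials and success probability `1 - q^k` (`weightLaw_card_reached_le`). A Chernoff bound turns
this into `exp (-D²/(4n))`, where `D` is the distance of `k - m` from the binomial mean. For small
`m`, `D` is close to `-n * drift t (k/n)`.

The drift is concave in `x` and vanishes at `0` and `ρ`. It is therefore bounded below on a window
`[δ/2, δ]`, and beyond `δ/2` it is at least a multiple of `|x - ρ|`. This has two consequences. The
total size of the components of the first `i` vertices is unlikely to fall in `[δn/2, δn]` for any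
`i`; since it grows from `0` to `n`, it must jump the window, and a jump is a single component of
size at least `δn/2` (`exists_card_component_ge`). A single component of size at least `δn/2` is
also unlikely to be far from `nρ`, with a Gaussian cost (`weightLaw_card_component_le`). The union
bounds cost only `(n+1)²`, which half of the exponent absorbs. -/

namespace RandomGraphFlow

/-! ### Exploration from a seed set. -/

/-- Every proper subset of `V` containing `S` is joined by an edge to its complement in `V`;
equivalently, every vertex of `V` is reached from `S` inside `V`. -/
def Spans {α : Type*} [DecidableEq α] (G : SimpleGraph α) (S V : Finset α) : Prop :=
  ∀ U, S ⊆ U → U ⊂ V → ∃ x ∈ U, ∃ y ∈ V \ U, G.Adj x y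

section Spans

variable {α : Type*} [DecidableEq α] {G : SimpleGraph α} {S V : Finset α}

theorem Spans.nonempty (h : Spans G S V) (hV : V.Nonempty) : S.Nonempty := by
  by_contra hS
  rw [Finset.not_nonempty_iff_eq_empty] at hS
  obtain ⟨x, hx, -⟩ := h ∅ (by simp [hS]) (Finset.empty_ssubset.2 hV)
  simp at hx

/-- One exploration step: `v` is processed and its new neighbours become seeds. The crossing edge
that `insert v U` must have cannot start at `v`, since every neighbour of `v` in `V` is `v`'s fellow
seed or lies in `J`, hence is already in `U`. -/
theorem Spans.erase (h : Spans G S V) {v : α} (hv : v ∈ S) {J : Finset α}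
    (hV : S ⊆ V) (hJ : ∀ y ∈ V \ S, G.Adj v y → y ∈ J) :
    Spans G (S.erase v ∪ J) (V.erase v) := by
  intro U hSU hUV
  have hvU : v ∉ U := fun hmem => by simpa using hUV.1 hmem
  have hU : U ⊆ V := hUV.1.trans (Finset.erase_subset _ _)
  obtain ⟨z, hz, hzU⟩ := Finset.exists_of_ssubset hUV
  have hsub : insert v U ⊂ V := by
    refine Finset.ssubset_iff_subset_ne.2 ⟨Finset.insert_subset (hV hv) hU, ?_⟩
    rintro rfl
    simp only [Finset.mem_erase, Finset.mem_insert] at hz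
    tauto
  have hSv : S ⊆ insert v U := by
    intro s hs
    by_cases hsv : s = v
    · simp [hsv]
    · exact Finset.mem_insert_of_mem
        (hSU (Finset.mem_union_left _ (Finset.mem_erase.2 ⟨hsv, hs⟩)))
  obtain ⟨x, hx, y, hy, hxy⟩ := h _ hSv hsub
  rw [Finset.mem_sdiff, Finset.mem_insert, not_or] at hy
  rcases Finset.mem_insert.1 hx with rfl | hx
  · exfalso
    refine hy.2.2 (hSU (Finset.mem_union_right _ (hJ y ?_ hxy)))
    refine Finset.mem_sdiff.2 ⟨hy.1, fun hyS => hy.2.2 (hSU (Finset.mem_union_left _ ?_))⟩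
    exact Finset.mem_erase.2 ⟨hy.2.1, hyS⟩
  · exact ⟨x, hx, y, by simp [hy], hxy⟩

end Spans

/-! ### Unions of components. -/

section Closure

variable {α : Type*} [Fintype α] (G : SimpleGraph α)

open Classical in
/-- The union of the connected components meeting `M`. -/
noncomputable def reached (M : Finset α) : Finset α :=
  Finset.univ.filter fun x => ∃ m ∈ M, G.Reachable m x

variable {G}

theorem mem_reached {M : Finset α} {x : α} : x ∈ reached G M ↔ ∃ m ∈ M, G.Reachable m x := by
  simp [reached]

theorem subset_reached (M : Finset α) : M ⊆ reached G M :=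
  fun x hx => mem_reached.2 ⟨x, hx, .rfl⟩

theorem reached_closed {M : Finset α} {x y : α} (hx : x ∈ reached G M) (h : G.Adj x y) :
    y ∈ reached G M := by
  obtain ⟨m, hm, hr⟩ := mem_reached.1 hx
  exact mem_reached.2 ⟨m, hm, hr.trans h.reachable⟩

theorem reached_subset {M U : Finset α} (hM : M ⊆ U) (hU : ∀ x ∈ U, ∀ y, G.Adj x y → y ∈ U) :
    reached G M ⊆ U := by
  intro x hx
  obtain ⟨m, hm, ⟨p⟩⟩ := mem_reached.1 hx
  have key : ∀ {a b : α}, G.Walk a b → a ∈ U → b ∈ U := by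
    intro a b q
    induction q with
    | nil => exact id
    | cons h _ ih => exact fun ha => ih (hU _ ha _ h)
  exact key p (hM hm)

theorem card_reached_singleton (v : α) :
    (reached G {v}).card = (G.connectedComponentMk v).supp.ncard := by
  rw [← Set.ncard_coe_finset]
  congr 1
  ext x
  simp [mem_reached, SimpleGraph.reachable_comm]

variable [DecidableEq α]

theorem spans_reached (M : Finset α) : Spans G M (reached G M) := by
  intro U hM hU
  by_contra! hcon
  refine hU.2 (reached_subset hM fun x hx y hxy => ?_)
  by_contra hy
  exact hcon x hx y (Finset.mem_sdiff.2 ⟨reached_closed (hU.1 hx) hxy, hy⟩) hxy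

theorem reached_union (M N : Finset α) : reached G (M ∪ N) = reached G M ∪ reached G N := by
  ext x
  simp only [mem_reached, Finset.mem_union]
  constructor
  · rintro ⟨m, hm | hm, h⟩
    exacts [.inl ⟨m, hm, h⟩, .inr ⟨m, hm, h⟩]
  · rintro (⟨m, hm, h⟩ | ⟨m, hm, h⟩)
    exacts [⟨m, .inl hm, h⟩, ⟨m, .inr hm, h⟩]

end Closure

/-! ### The binomial bound for the number of reached vertices. -/

section Probability

variable {n : ℕ}

theorem weightLaw_inter_eq_mul {S T : Finset (Sym2 (Fin n))} (hST : Disjoint S T)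
    {E F : Set (Sym2 (Fin n) → ℝ)} (hE : MeasurableSet E) (hF : MeasurableSet F)
    (hES : DependsOn (· ∈ E) (S : Set (Sym2 (Fin n))))
    (hFT : DependsOn (· ∈ F) (T : Set (Sym2 (Fin n)))) :
    (weightLaw n).real (E ∩ F) = (weightLaw n).real E * (weightLaw n).real F := by
  classical
  -- Extension by zero exhibits an event depending only on `R` as a preimage under restriction to
  -- `R`, the form that independence of coordinate blocks requires.
  let ext (R : Finset (Sym2 (Fin n))) (u : R → ℝ) (e : Sym2 (Fin n)) : ℝ :=
    if h : e ∈ R then u ⟨e, h⟩ else 0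
  have hext : ∀ R, Measurable (ext R) := by
    intro R
    refine measurable_pi_lambda _ fun e => ?_
    by_cases h : e ∈ R
    · simpa [ext, h] using measurable_pi_apply _
    · simp [ext, h]
  have hpre : ∀ (R : Finset (Sym2 (Fin n))) (A : Set (Sym2 (Fin n) → ℝ)),
      DependsOn (· ∈ A) (R : Set (Sym2 (Fin n))) →
      (fun (w : Sym2 (Fin n) → ℝ) (e : R) => w e) ⁻¹' (ext R ⁻¹' A) = A := by
    intro R A hA
    ext w
    refine iff_of_eq (hA ?_)
    intro e he
    have he : e ∈ R := he
    simp [ext, he]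
  have hprob : IsProbabilityMeasure (volume.restrict (Set.Icc (0 : ℝ) 1)) := ⟨by simp⟩
  have hind : ProbabilityTheory.iIndepFun (fun (e : Sym2 (Fin n)) (w : Sym2 (Fin n) → ℝ) => w e)
      (weightLaw n) :=
    ProbabilityTheory.iIndepFun_pi (X := fun _ x => x) fun _ => aemeasurable_id
  have h := (hind.indepFun_finset S T hST fun e => measurable_pi_apply e).measure_inter_preimage_eq_mul
    _ _ ((hext S) hE) ((hext T) hF)
  rw [hpre S E hES, hpre T F hFT] at h
  simp [Measure.real, h]

theorem unitInterval_real_Iio {p : ℝ} (h0 : 0 ≤ p) (h1 : p ≤ 1) :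
    (volume.restrict (Set.Icc (0 : ℝ) 1)).real (Set.Iio p) = p := by
  rw [measureReal_restrict_apply measurableSet_Iio]
  have : Set.Iio p ∩ Set.Icc (0 : ℝ) 1 = Set.Ico 0 p := by
    ext x
    simp only [Set.mem_inter_iff, Set.mem_Iio, Set.mem_Icc, Set.mem_Ico]
    constructor
    · rintro ⟨a, b, c⟩; exact ⟨b, a⟩
    · rintro ⟨a, b⟩; exact ⟨b, a, by linarith⟩
  rw [this]
  simp [h0]

theorem unitInterval_real_Ici {p : ℝ} (h0 : 0 ≤ p) (h1 : p ≤ 1) :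
    (volume.restrict (Set.Icc (0 : ℝ) 1)).real (Set.Ici p) = 1 - p := by
  rw [measureReal_restrict_apply measurableSet_Ici]
  have : Set.Ici p ∩ Set.Icc (0 : ℝ) 1 = Set.Icc p 1 := by
    ext x
    simp only [Set.mem_inter_iff, Set.mem_Ici, Set.mem_Icc]
    constructor
    · rintro ⟨a, b, c⟩; exact ⟨a, c⟩
    · rintro ⟨a, b⟩; exact ⟨a, by linarith, b⟩
  rw [this]
  simp [h1]

/-- Probability that all pairs in `A` and no pair in `B` are present. -/
theorem weightLaw_pattern {p : ℝ} (h0 : 0 ≤ p) (h1 : p ≤ 1) {A B : Finset (Sym2 (Fin n))}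
    (hAB : Disjoint A B) :
    (weightLaw n).real {w | (∀ e ∈ A, w e < p) ∧ ∀ e ∈ B, ¬ w e < p} =
      p ^ A.card * (1 - p) ^ B.card := by
  classical
  have hprob : IsProbabilityMeasure (volume.restrict (Set.Icc (0 : ℝ) 1)) := ⟨by simp⟩
  let s : Sym2 (Fin n) → Set ℝ := fun e =>
    if e ∈ A then Set.Iio p else if e ∈ B then Set.Ici p else Set.univ
  have hset : {w : Sym2 (Fin n) → ℝ | (∀ e ∈ A, w e < p) ∧ ∀ e ∈ B, ¬ w e < p} =
      Set.pi Set.univ s := by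
    ext w
    simp only [Set.mem_ofPred_eq, Set.mem_pi, Set.mem_univ, true_imp_iff, s]
    constructor
    · rintro ⟨ha, hb⟩ e
      by_cases hA : e ∈ A
      · simpa [hA] using ha e hA
      · by_cases hB : e ∈ B
        · simpa [hA, hB] using hb e hB
        · simp [hA, hB]
    · intro h
      refine ⟨fun e he => by simpa [he] using h e, fun e he => ?_⟩
      have hA : e ∉ A := Finset.disjoint_right.1 hAB he
      simpa [he, hA] using h e
  have hval : ∀ e, (volume.restrict (Set.Icc (0 : ℝ) 1)).real (s e) =
      (if e ∈ A then p else 1) * (if e ∈ B then 1 - p else 1) := by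
    intro e
    by_cases hA : e ∈ A
    · have hB : e ∉ B := Finset.disjoint_left.1 hAB hA
      simpa [s, hA, hB] using unitInterval_real_Iio h0 h1
    · by_cases hB : e ∈ B
      · simpa [s, hA, hB] using unitInterval_real_Ici h0 h1
      · simp [s, hA, hB, Measure.real]
  rw [hset, Measure.real, weightLaw, Measure.pi_pi, ENNReal.toReal_prod]
  refine (Finset.prod_congr rfl fun e _ => hval e).trans ?_
  rw [Finset.prod_mul_distrib]
  simp

theorem graph_adj {t : ℝ} {w : Sym2 (Fin n) → ℝ} {x y : Fin n} :
    (graph n t w).Adj x y ↔ w s(x, y) < t / n ∧ x ≠ y := by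
  simp [graph]

theorem measurableSet_adj (t : ℝ) (x y : Fin n) :
    MeasurableSet {w | (graph n t w).Adj x y} := by
  simp only [graph_adj]
  exact (measurableSet_lt (measurable_pi_apply _) measurable_const).inter (MeasurableSet.const _)

theorem measurableSet_spans (t : ℝ) (S V : Finset (Fin n)) :
    MeasurableSet {w | Spans (graph n t w) S V} := by
  have : {w | Spans (graph n t w) S V} = ⋂ U : Finset (Fin n), ⋂ _ : S ⊆ U, ⋂ _ : U ⊂ V,
      ⋃ x ∈ U, ⋃ y ∈ V \ U, {w | (graph n t w).Adj x y} := by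
    ext w
    simp only [Spans, Set.mem_ofPred_eq, Set.mem_iInter, Set.mem_iUnion, exists_prop]
  rw [this]
  exact .iInter fun U => .iInter fun _ => .iInter fun _ =>
    Finset.measurableSet_biUnion _ fun x _ => Finset.measurableSet_biUnion _ fun y _ =>
      measurableSet_adj t x y

theorem dependsOn_spans (t : ℝ) (S V : Finset (Fin n)) {T : Finset (Sym2 (Fin n))}
    (hT : ∀ x ∈ V, ∀ y ∈ V, s(x, y) ∈ T) :
    DependsOn (· ∈ {w | Spans (graph n t w) S V}) (T : Set (Sym2 (Fin n))) := by
  have key : ∀ w w' : Sym2 (Fin n) → ℝ, (∀ e ∈ (T : Set (Sym2 (Fin n))), w e = w' e) →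
      Spans (graph n t w) S V → Spans (graph n t w') S V := by
    intro w w' hww h U hSU hUV
    obtain ⟨x, hx, y, hy, hxy⟩ := h U hSU hUV
    refine ⟨x, hx, y, hy, ?_⟩
    rw [graph_adj] at hxy ⊢
    rwa [← hww _ (hT x (hUV.1 hx) y (Finset.mem_sdiff.1 hy).1)]
  intro w w' hww
  exact propext ⟨key w w' hww, key w' w fun e he => (hww e he).symm⟩

theorem dependsOn_pattern (p : ℝ) (A B : Finset (Sym2 (Fin n))) :
    DependsOn (· ∈ {w : Sym2 (Fin n) → ℝ | (∀ e ∈ A, w e < p) ∧ ∀ e ∈ B, ¬ w e < p})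
      ((A ∪ B : Finset (Sym2 (Fin n))) : Set (Sym2 (Fin n))) := by
  intro w w' hww
  have hA : ∀ e ∈ A, w e = w' e := fun e he => hww e (by simp [he])
  have hB : ∀ e ∈ B, w e = w' e := fun e he => hww e (by simp [he])
  simp only [Set.mem_ofPred_eq]
  congr 1
  · exact propext (forall₂_congr fun e he => by rw [hA e he])
  · exact propext (forall₂_congr fun e he => by rw [hB e he])

theorem measurableSet_pattern (p : ℝ) (A B : Finset (Sym2 (Fin n))) :
    MeasurableSet {w : Sym2 (Fin n) → ℝ | (∀ e ∈ A, w e < p) ∧ ∀ e ∈ B, ¬ w e < p} := by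
  have hlt : ∀ e, MeasurableSet {w : Sym2 (Fin n) → ℝ | w e < p} := fun e =>
    measurableSet_lt (measurable_pi_apply e) measurable_const
  have : {w : Sym2 (Fin n) → ℝ | (∀ e ∈ A, w e < p) ∧ ∀ e ∈ B, ¬ w e < p} =
      (⋂ e ∈ A, {w | w e < p}) ∩ ⋂ e ∈ B, {w | w e < p}ᶜ := by
    ext w
    simp
  rw [this]
  exact (Finset.measurableSet_biInter _ fun e _ => hlt e).inter
    (Finset.measurableSet_biInter _ fun e _ => (hlt e).compl)

/-- The bound is the probability that each of the `V.card - S.card` non-seeds succeeds in at least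
one of `V.card` independent trials. Induct on `V.card`: reveal the pairs from a seed `v` to `V \ S`,
let `J` be those present, and apply the induction hypothesis to `V.erase v`, whose pairs are still
fresh. The sum over `J` is a binomial expansion. The loss comes from explorations that run out of
seeds, where the true probability is zero. -/
theorem weightLaw_spans_le {t : ℝ} (h0 : 0 ≤ t / n) (h1 : t / n ≤ 1) (S V : Finset (Fin n))
    (hSV : S ⊆ V) :
    (weightLaw n).real {w | Spans (graph n t w) S V} ≤
      (1 - (1 - t / n) ^ V.card) ^ (V.card - S.card) := by
  induction hk : V.card generalizing S V with
  | zero =>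
    have : S = ∅ := Finset.subset_empty.1 (Finset.card_eq_zero.1 hk ▸ hSV)
    simp [measureReal_le_one]
  | succ k ih =>
    set p : ℝ := t / n with hp
    have hV : V.Nonempty := Finset.card_pos.1 (by omega)
    have hqk : ∀ m, (1 - p) ^ m ≤ 1 := fun m => pow_le_one₀ (by linarith) (by linarith)
    rcases S.eq_empty_or_nonempty with rfl | ⟨v, hv⟩
    · have : {w | Spans (graph n t w) ∅ V} = ∅ := by
        ext w
        simp only [Set.mem_ofPred_eq, Set.mem_empty_iff_false, iff_false]
        exact fun h => by simpa using h.nonempty hV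
      rw [this, measureReal_empty]
      exact pow_nonneg (by linarith [hqk (k + 1)]) _
    have hinj : Function.Injective fun y : Fin n => s(v, y) := fun a b h => by
      rcases Sym2.eq_iff.1 h with ⟨-, h⟩ | ⟨h, h'⟩
      exacts [h, h'.trans h]
    let A (J : Finset (Fin n)) : Finset (Sym2 (Fin n)) := J.image fun y => s(v, y)
    let B (J : Finset (Fin n)) : Finset (Sym2 (Fin n)) := ((V \ S) \ J).image fun y => s(v, y)
    let Pat (J : Finset (Fin n)) : Set (Sym2 (Fin n) → ℝ) :=
      {w | (∀ e ∈ A J, w e < p) ∧ ∀ e ∈ B J, ¬ w e < p}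
    let R (J : Finset (Fin n)) : Set (Sym2 (Fin n) → ℝ) :=
      {w | Spans (graph n t w) (S.erase v ∪ J) (V.erase v)}
    have hcover : {w | Spans (graph n t w) S V} ⊆ ⋃ J ∈ (V \ S).powerset, Pat J ∩ R J := by
      intro w hw
      classical
      let J := (V \ S).filter fun y => w s(v, y) < p
      have hpat : w ∈ Pat J := by
        constructor
        · intro e he
          obtain ⟨y, hy, rfl⟩ := Finset.mem_image.1 he
          exact (Finset.mem_filter.1 hy).2
        · intro e he
          obtain ⟨y, hy, rfl⟩ := Finset.mem_image.1 he
          rw [Finset.mem_sdiff] at hy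
          exact fun hlt => hy.2 (Finset.mem_filter.2 ⟨hy.1, hlt⟩)
      have hR : w ∈ R J := Spans.erase hw hv hSV fun y hy hadj =>
        Finset.mem_filter.2 ⟨hy, (graph_adj.1 hadj).1⟩
      exact Set.mem_biUnion (x := J) (Finset.mem_powerset.2 (Finset.filter_subset _ _)) ⟨hpat, hR⟩
    have hcard : (V.erase v).card = k := by rw [Finset.card_erase_of_mem (hSV hv)]; omega
    have hSpos : 0 < S.card := Finset.card_pos.2 ⟨v, hv⟩
    have hSle : S.card ≤ k + 1 := hk ▸ Finset.card_le_card hSV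
    have hr : (V \ S).card = k + 1 - S.card := by rw [Finset.card_sdiff_of_subset hSV, hk]
    have hterm : ∀ J ∈ (V \ S).powerset, (weightLaw n).real (Pat J ∩ R J) ≤
        p ^ J.card * ((1 - p) * (1 - (1 - p) ^ k)) ^ ((V \ S).card - J.card) := by
      intro J hJ
      rw [Finset.mem_powerset] at hJ
      have hJS : ∀ y ∈ J, y ∈ V ∧ y ∉ S := fun y hy => by simpa using hJ hy
      have hdis : Disjoint (A J) (B J) := by
        refine (Finset.disjoint_image hinj).2 Finset.disjoint_sdiff
      have hsub : S.erase v ∪ J ⊆ V.erase v := by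
        refine Finset.union_subset (Finset.erase_subset_erase _ hSV) fun y hy => ?_
        exact Finset.mem_erase.2 ⟨fun h => (hJS y hy).2 (h ▸ hv), (hJS y hy).1⟩
      have hunion : (S.erase v ∪ J).card = S.card - 1 + J.card := by
        rw [Finset.card_union_of_disjoint, Finset.card_erase_of_mem hv]
        exact Finset.disjoint_left.2 fun y hy hyJ => (hJS y hyJ).2 (Finset.mem_of_mem_erase hy)
      let T : Finset (Sym2 (Fin n)) := (V.erase v).sym2
      have hAT : Disjoint (A J ∪ B J) T := by
        rw [Finset.disjoint_left]
        intro e he heT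
        have : v ∈ e := by
          rcases Finset.mem_union.1 he with he | he <;>
          · obtain ⟨y, -, rfl⟩ := Finset.mem_image.1 he
            simp
        simpa using Finset.mem_sym2_iff.1 heT v this
      rw [weightLaw_inter_eq_mul hAT (measurableSet_pattern p _ _) (measurableSet_spans t _ _)
        (dependsOn_pattern p _ _)
        (dependsOn_spans t _ _ fun x hx y hy => Finset.mk_mem_sym2_iff.2 ⟨hx, hy⟩),
        weightLaw_pattern h0 h1 hdis, Finset.card_image_of_injective _ hinj,
        Finset.card_image_of_injective _ hinj, Finset.card_sdiff_of_subset hJ, mul_pow, mul_assoc]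
      have hih := ih _ _ hsub hcard
      have hexp : k - (S.erase v ∪ J).card = (V \ S).card - J.card := by
        rw [hunion, hr]; omega
      rw [hexp] at hih
      have : 0 ≤ 1 - p := by linarith
      gcongr
    calc (weightLaw n).real {w | Spans (graph n t w) S V}
        ≤ (weightLaw n).real (⋃ J ∈ (V \ S).powerset, Pat J ∩ R J) := measureReal_mono hcover (measure_ne_top _ _)
      _ ≤ ∑ J ∈ (V \ S).powerset, (weightLaw n).real (Pat J ∩ R J) :=
          measureReal_biUnion_finset_le _ _
      _ ≤ ∑ J ∈ (V \ S).powerset,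
          p ^ J.card * ((1 - p) * (1 - (1 - p) ^ k)) ^ ((V \ S).card - J.card) :=
          Finset.sum_le_sum hterm
      _ = (p + (1 - p) * (1 - (1 - p) ^ k)) ^ (V \ S).card := Finset.sum_pow_mul_eq_add_pow _ _ _
      _ = (1 - (1 - p) ^ (k + 1)) ^ (k + 1 - S.card) := by rw [hr]; ring

/-- Two independent requirements: `M` spans `V` using pairs inside `V`, and all pairs between `V`
and its complement are absent. -/
theorem weightLaw_reached_eq_le {t : ℝ} (h0 : 0 ≤ t / n) (h1 : t / n ≤ 1) (M V : Finset (Fin n))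
    (hMV : M ⊆ V) :
    (weightLaw n).real {w | reached (graph n t w) M = V} ≤
      (1 - (1 - t / n) ^ V.card) ^ (V.card - M.card) *
        ((1 - t / n) ^ V.card) ^ (n - V.card) := by
  set p : ℝ := t / n with hp
  let B : Finset (Sym2 (Fin n)) := (V ×ˢ Vᶜ).image fun z => s(z.1, z.2)
  have hB : B.card = V.card * (n - V.card) := by
    rw [Finset.card_image_of_injOn, Finset.card_product, Finset.card_compl, Fintype.card_fin]
    rintro ⟨a, b⟩ hab ⟨c, d⟩ hcd h
    simp only [Finset.coe_product, Set.mem_prod, Finset.mem_coe, Finset.mem_compl] at hab hcd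
    simp only [Sym2.eq_iff] at h
    rcases h with ⟨rfl, rfl⟩ | ⟨rfl, rfl⟩
    · rfl
    · exact absurd hab.1 hcd.2
  let Pat : Set (Sym2 (Fin n) → ℝ) :=
    {w | (∀ e ∈ (∅ : Finset (Sym2 (Fin n))), w e < p) ∧ ∀ e ∈ B, ¬ w e < p}
  have hsub : {w | reached (graph n t w) M = V} ⊆ Pat ∩ {w | Spans (graph n t w) M V} := by
    intro w hw
    have hw : reached (graph n t w) M = V := hw
    refine ⟨⟨by simp, ?_⟩, hw ▸ spans_reached M⟩
    intro e he hlt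
    obtain ⟨⟨a, b⟩, hab, rfl⟩ := Finset.mem_image.1 he
    rw [Finset.mem_product, Finset.mem_compl] at hab
    have hne : a ≠ b := fun h => hab.2 (h ▸ hab.1)
    exact hab.2 (hw ▸ reached_closed (hw.symm ▸ hab.1) (graph_adj.2 ⟨hlt, hne⟩))
  have hdis : Disjoint (∅ ∪ B) V.sym2 := by
    rw [Finset.empty_union, Finset.disjoint_left]
    intro e he heV
    obtain ⟨⟨a, b⟩, hab, rfl⟩ := Finset.mem_image.1 he
    rw [Finset.mem_product, Finset.mem_compl] at hab
    exact hab.2 (Finset.mk_mem_sym2_iff.1 heV).2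
  refine (measureReal_mono hsub).trans ?_
  rw [weightLaw_inter_eq_mul hdis (measurableSet_pattern p _ _) (measurableSet_spans t _ _)
    (dependsOn_pattern p _ _)
    (dependsOn_spans t _ _ fun x hx y hy => Finset.mk_mem_sym2_iff.2 ⟨hx, hy⟩),
    weightLaw_pattern h0 h1 (Finset.disjoint_empty_left _), hB, mul_comm, pow_mul]
  have : 0 ≤ 1 - p := by linarith
  simp only [Finset.card_empty, pow_zero, one_mul]
  gcongr
  exact weightLaw_spans_le h0 h1 M V hMV

/-- The number of vertices reached from `M` is `k` with at most a binomial probability. -/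
theorem weightLaw_card_reached_le {t : ℝ} (h0 : 0 ≤ t / n) (h1 : t / n ≤ 1) (M : Finset (Fin n))
    {k : ℕ} (hMk : M.card ≤ k) :
    (weightLaw n).real {w | (reached (graph n t w) M).card = k} ≤
      (n - M.card).choose (k - M.card) * (1 - (1 - t / n) ^ k) ^ (k - M.card) *
        ((1 - t / n) ^ k) ^ (n - k) := by
  classical
  let F : Finset (Finset (Fin n)) := (Mᶜ.powersetCard (k - M.card)).image (M ∪ ·)
  have hF : F.card ≤ (n - M.card).choose (k - M.card) := by
    refine Finset.card_image_le.trans ?_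
    rw [Finset.card_powersetCard, Finset.card_compl, Fintype.card_fin]
  have hsub : {w | (reached (graph n t w) M).card = k} ⊆
      ⋃ V ∈ F, {w | reached (graph n t w) M = V} := by
    intro w hw
    have hw : (reached (graph n t w) M).card = k := hw
    have hM := subset_reached (G := graph n t w) M
    refine Set.mem_biUnion (x := reached (graph n t w) M) ?_ rfl
    refine Finset.mem_coe.2 (Finset.mem_image.2 ⟨reached (graph n t w) M \ M, ?_, ?_⟩)
    · rw [Finset.mem_powersetCard, Finset.card_sdiff_of_subset hM, hw]
      exact ⟨fun x hx => Finset.mem_compl.2 (Finset.mem_sdiff.1 hx).2, rfl⟩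
    · exact Finset.union_sdiff_of_subset hM
  have hV : ∀ V ∈ F, M ⊆ V ∧ V.card = k := by
    intro V hVF
    obtain ⟨U, hU, rfl⟩ := Finset.mem_image.1 hVF
    rw [Finset.mem_powersetCard] at hU
    refine ⟨Finset.subset_union_left, ?_⟩
    rw [Finset.card_union_of_disjoint, hU.2]
    · omega
    · exact Finset.disjoint_left.2 fun x hx hxU => Finset.mem_compl.1 (hU.1 hxU) hx
  have hq0 : 0 ≤ 1 - t / n := by linarith
  have hq1 : (1 - t / n) ^ k ≤ 1 := pow_le_one₀ hq0 (by linarith)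
  calc (weightLaw n).real {w | (reached (graph n t w) M).card = k}
      ≤ (weightLaw n).real (⋃ V ∈ F, {w | reached (graph n t w) M = V}) :=
        measureReal_mono hsub (measure_ne_top _ _)
    _ ≤ ∑ V ∈ F, (weightLaw n).real {w | reached (graph n t w) M = V} :=
        measureReal_biUnion_finset_le _ _
    _ ≤ ∑ V ∈ F, (1 - (1 - t / n) ^ k) ^ (k - M.card) * ((1 - t / n) ^ k) ^ (n - k) := by
        refine Finset.sum_le_sum fun V hVF => ?_
        obtain ⟨hMV, hVk⟩ := hV V hVF
        simpa [hVk] using weightLaw_reached_eq_le h0 h1 M V hMV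
    _ ≤ _ := by
        rw [Finset.sum_const, nsmul_eq_mul, mul_assoc]
        have : 0 ≤ 1 - (1 - t / n) ^ k := by linarith
        gcongr

end Probability

/-! ### A Chernoff bound for binomial point probabilities. -/

section Binomial

theorem one_add_mul_exp_sub_one_le {a θ : ℝ} (ha0 : 0 ≤ a) (ha1 : a ≤ 1) (hθ : |θ| ≤ 1) :
    a * Real.exp θ + (1 - a) ≤ Real.exp (a * θ + θ ^ 2) := by
  have h1 : Real.exp θ ≤ 1 + θ + θ ^ 2 := by
    have := Real.abs_exp_sub_one_sub_id_le hθ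
    linarith [(abs_le.1 this).2]
  have h2 := Real.add_one_le_exp (a * θ + θ ^ 2)
  nlinarith [sq_nonneg θ, mul_le_mul_of_nonneg_left h1 ha0,
    mul_nonneg (sub_nonneg.2 ha1) (sq_nonneg θ)]

theorem choose_mul_pow_le_exp {N j : ℕ} {n a : ℝ} (hN : (N : ℝ) ≤ n) (hn : 0 < n) (hj : j ≤ N)
    (ha0 : 0 ≤ a) (ha1 : a ≤ 1) :
    (N.choose j : ℝ) * a ^ j * (1 - a) ^ (N - j) ≤ Real.exp (-((j - N * a) ^ 2 / (4 * n))) := by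
  have hNn : (0 : ℝ) ≤ N := Nat.cast_nonneg N
  have hjN : (j : ℝ) ≤ N := Nat.cast_le.2 hj
  have hj0 : (0 : ℝ) ≤ j := Nat.cast_nonneg j
  -- This tilt minimises `n * θ ^ 2 - (j - N * a) * θ`, the exponent left once `N` is replaced by
  -- `n`.
  set θ : ℝ := (j - N * a) / (2 * n) with hθ
  have hθ1 : |θ| ≤ 1 := by
    rw [hθ, abs_div, abs_of_pos (by linarith : 0 < 2 * n), div_le_one (by linarith), abs_le]
    constructor <;> nlinarith [mul_nonneg hNn ha0, mul_le_of_le_one_right hNn ha1]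
  have hsum : (a * Real.exp θ) ^ j * (1 - a) ^ (N - j) * N.choose j ≤
      (a * Real.exp θ + (1 - a)) ^ N := by
    rw [add_pow]
    refine Finset.single_le_sum
      (f := fun m => (a * Real.exp θ) ^ m * (1 - a) ^ (N - m) * (N.choose m : ℝ))
      (fun m _ => ?_) (Finset.mem_range.2 (by omega))
    have := sub_nonneg.2 ha1
    positivity
  have hpow : (a * Real.exp θ + (1 - a)) ^ N ≤ Real.exp (N * (a * θ + θ ^ 2)) := by
    rw [Real.exp_nat_mul]
    have := sub_nonneg.2 ha1
    exact pow_le_pow_left₀ (by positivity) (one_add_mul_exp_sub_one_le ha0 ha1 hθ1) N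
  have hmul : (N.choose j : ℝ) * a ^ j * (1 - a) ^ (N - j) * Real.exp (j * θ) ≤
      Real.exp (N * (a * θ + θ ^ 2)) := by
    refine le_trans (le_of_eq ?_) (hsum.trans hpow)
    rw [mul_pow, Real.exp_nat_mul]
    ring
  rw [← le_div_iff₀ (Real.exp_pos _), ← Real.exp_sub] at hmul
  refine hmul.trans (Real.exp_le_exp.2 ?_)
  have h1 : N * θ ^ 2 ≤ n * θ ^ 2 := by gcongr
  have h2 : (j - N * a) = 2 * n * θ := by rw [hθ]; field_simp
  have h3 : (j - N * a) ^ 2 / (4 * n) = n * θ ^ 2 := by rw [h2]; field_simp; ring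
  rw [h3]
  linear_combination h1 + (-θ) * h2

end Binomial

/-! ### Concavity of the limiting drift. -/

section Drift

/-- The limiting drift `1 - e^{-tx} - x` of the exploration. -/
noncomputable def drift (t x : ℝ) : ℝ := 1 - Real.exp (-(t * x)) - x

theorem concaveOn_drift (t : ℝ) : ConcaveOn ℝ Set.univ (drift t) := by
  have h : ConvexOn ℝ Set.univ fun x : ℝ => Real.exp (-(t * x)) := by
    have := convexOn_exp.comp_linearMap ((-t) • (LinearMap.id : ℝ →ₗ[ℝ] ℝ))
    simpa [Function.comp_def] using this
  have := ((concaveOn_const (1 : ℝ) convex_univ).sub h).sub (convexOn_id convex_univ)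
  exact this

@[simp] theorem drift_zero (t : ℝ) : drift t 0 = 0 := by simp [drift]

theorem drift_rho {t : ℝ} (ht : 1 < t) : drift t (rho t) = 0 := by
  have := (rho_spec ht).2
  simp only [drift]
  linarith

/-- This makes the estimates uniform in time: a `δ` chosen at `t₀` works for every later `t`, with
at least the same drift. -/
theorem drift_mono {s t x : ℝ} (hst : s ≤ t) (hx : 0 ≤ x) : drift s x ≤ drift t x := by
  have : Real.exp (-(t * x)) ≤ Real.exp (-(s * x)) := by
    gcongr
  simp only [drift]
  linarith

theorem exists_drift_pos {t : ℝ} (ht : 1 < t) : ∃ δ, 0 < δ ∧ δ < 1 ∧ 0 < drift t δ := by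
  have hr := rho_spec ht
  obtain ⟨⟨h0, h1⟩, -⟩ := hr
  refine ⟨rho t / 2, by linarith, by linarith, ?_⟩
  have h := strictConvexOn_exp.2 (Set.mem_univ (-(t * rho t))) (Set.mem_univ (0 : ℝ))
    (by have := mul_pos (by linarith : 0 < t) h0; linarith) (by norm_num : (0 : ℝ) < 1 / 2)
    (by norm_num : (0 : ℝ) < 1 / 2) (by norm_num)
  simp only [smul_eq_mul, mul_zero, add_zero, Real.exp_zero, mul_one] at h
  have hd := drift_rho ht
  simp only [drift] at hd ⊢
  rw [show -(t * (rho t / 2)) = 1 / 2 * -(t * rho t) by ring]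
  linarith

/-- Jensen's inequality for a point of the segment `[x, z]`, without division. -/
theorem drift_chord (t : ℝ) {x y z : ℝ} (hxy : x ≤ y) (hyz : y ≤ z) (hxz : x < z) :
    (z - y) * drift t x + (y - x) * drift t z ≤ (z - x) * drift t y := by
  have hzx : 0 < z - x := by linarith
  have h := (concaveOn_drift t).2 (Set.mem_univ x) (Set.mem_univ z)
    (div_nonneg (sub_nonneg.2 hyz) hzx.le) (div_nonneg (sub_nonneg.2 hxy) hzx.le)
    (by field_simp; ring)
  simp only [smul_eq_mul] at h
  rw [show (z - y) / (z - x) * x + (y - x) / (z - x) * z = y by field_simp; ring] at h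
  have h2 := mul_le_mul_of_nonneg_left h hzx.le
  calc _ = (z - x) * ((z - y) / (z - x) * drift t x + (y - x) / (z - x) * drift t z) := by
        field_simp
    _ ≤ _ := h2

/-- Half of the drift at `δ` bounds from below the slope of the drift towards its zero `ρ`. -/
theorem mul_abs_sub_rho_le {t δ x : ℝ} (ht : 1 < t) (hδ0 : 0 < δ) (hδ : 0 < drift t δ)
    (hx : δ / 2 ≤ x) : drift t δ / 2 * |x - rho t| ≤ |drift t x| := by
  obtain ⟨⟨hr0, hr1⟩, -⟩ := rho_spec ht
  have hr := drift_rho ht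
  have hδr : δ < rho t := by
    by_contra! hcon
    have := drift_chord t hr0.le hcon hδ0
    rw [drift_zero, hr] at this
    nlinarith
  set η := drift t δ with hη
  have hhalf : η / 2 ≤ drift t (δ / 2) := by
    have := drift_chord t (by linarith : (0 : ℝ) ≤ δ / 2) (by linarith : δ / 2 ≤ δ) hδ0
    rw [drift_zero, ← hη] at this
    nlinarith
  -- In both cases a chord with one end at `δ / 2` gives the slope; its factor `rho t - δ / 2` is
  -- less than `1` and can be dropped.
  rcases le_or_gt x (rho t) with h | h
  · have := drift_chord t hx h (by linarith)
    rw [hr] at this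
    have hpos : 0 ≤ drift t x := by nlinarith
    rw [abs_of_nonneg hpos, abs_of_nonpos (by linarith)]
    nlinarith
  · have := drift_chord t (by linarith : δ / 2 ≤ rho t) h.le (by linarith)
    rw [hr] at this
    have hneg : drift t x ≤ 0 := by nlinarith
    rw [abs_of_nonpos hneg, abs_of_pos (by linarith)]
    nlinarith

theorem half_drift_le {t δ x : ℝ} (hδ0 : 0 < δ) (hδ : 0 < drift t δ)
    (hx : δ / 2 ≤ x) (hx' : x ≤ δ) : drift t δ / 2 ≤ drift t x := by
  have := drift_chord t (by linarith : 0 ≤ x) hx' hδ0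
  rw [drift_zero] at this
  nlinarith

end Drift

/-! ### Comparison of `(1 - t/n)^k` with `exp (-tk/n)`. -/

section PowExp

theorem one_sub_pow_le_exp {n : ℕ} {t : ℝ} (h1 : t / n ≤ 1) (k : ℕ) :
    (1 - t / n) ^ k ≤ Real.exp (-(t * (k / n))) := by
  have : 1 - t / n ≤ Real.exp (-(t / n)) := by linarith [Real.add_one_le_exp (-(t / n))]
  calc (1 - t / n) ^ k ≤ Real.exp (-(t / n)) ^ k := pow_le_pow_left₀ (by linarith) this k
    _ = Real.exp (-(t * (k / n))) := by rw [← Real.exp_nat_mul]; congr 1; ring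

/-- With `p = t/n`, raise `exp (-p) * (1 - 2p²) ≤ 1 - p` to the power `k`; Bernoulli's inequality
bounds the loss by `2kp² ≤ 2t²/n`. -/
theorem exp_le_one_sub_pow_add {n : ℕ} {t : ℝ} (hn : 1 ≤ n) (ht : 0 ≤ t) (h1 : t / n ≤ 1 / 2)
    {k : ℕ} (hk : k ≤ n) :
    Real.exp (-(t * (k / n))) ≤ (1 - t / n) ^ k + 2 * t ^ 2 / n := by
  have hn' : (0 : ℝ) < n := by exact_mod_cast hn
  set p := t / n with hp
  have hp0 : 0 ≤ p := by positivity
  have hkn : (k : ℝ) ≤ n := by exact_mod_cast hk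
  have hbase : Real.exp (-p) * (1 - 2 * p ^ 2) ≤ 1 - p := by
    have h2 := Real.add_one_le_exp p
    have h3 : Real.exp (-p) ≤ (1 + p)⁻¹ := by
      rw [Real.exp_neg]
      exact inv_anti₀ (by linarith) (by linarith)
    have h4 : (0 : ℝ) ≤ 1 - 2 * p ^ 2 := by nlinarith
    refine (mul_le_mul_of_nonneg_right h3 h4).trans ?_
    rw [inv_mul_le_iff₀ (by linarith)]
    nlinarith [sq_nonneg p]
  have hnn : (0 : ℝ) ≤ 1 - 2 * p ^ 2 := by nlinarith
  have hpow := pow_le_pow_left₀ (by positivity) hbase k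
  have hbern : 1 + (k : ℝ) * (-(2 * p ^ 2)) ≤ (1 + -(2 * p ^ 2)) ^ k :=
    one_add_mul_le_pow (by nlinarith) k
  have he : Real.exp (-(t * (k / n))) = Real.exp (-p) ^ k := by
    rw [← Real.exp_nat_mul, hp]; congr 1; ring
  have hle1 : Real.exp (-p) ^ k ≤ 1 := pow_le_one₀ (Real.exp_pos _).le (by simpa using hp0)
  have hpos : 0 ≤ Real.exp (-p) ^ k := by positivity
  have hsmall : (k : ℝ) * (2 * p ^ 2) ≤ 2 * t ^ 2 / n := by
    calc (k : ℝ) * (2 * p ^ 2) ≤ n * (2 * p ^ 2) := by gcongr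
      _ = 2 * t ^ 2 / n := by rw [hp]; field_simp
  rw [he]
  rw [mul_pow] at hpow
  have hs0 : 0 ≤ (k : ℝ) * (2 * p ^ 2) := by positivity
  have h5 := mul_le_mul_of_nonneg_left hbern hpos
  rw [← sub_eq_add_neg] at h5
  nlinarith [mul_le_mul_of_nonneg_right hle1 hs0]

end PowExp

/-! ### Tail bounds for reached sets and single components. -/

section Tail

variable {n : ℕ} {t : ℝ}

theorem weightLaw_card_reached_le_exp (hn : 1 ≤ n) (h0 : 0 ≤ t / n) (h1 : t / n ≤ 1)
    (M : Finset (Fin n)) (k : ℕ) :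
    (weightLaw n).real {w | (reached (graph n t w) M).card = k} ≤
      Real.exp (-(((k - M.card : ℝ) - (n - M.card) * (1 - (1 - t / n) ^ k)) ^ 2 / (4 * n))) := by
  by_cases hk : M.card ≤ k ∧ k ≤ n
  · obtain ⟨hMk, hkn⟩ := hk
    have hq0 : 0 ≤ (1 - t / n) ^ k := pow_nonneg (by linarith) k
    have hq1 : (1 - t / n) ^ k ≤ 1 := pow_le_one₀ (by linarith) (by linarith)
    have hn' : (0 : ℝ) < n := by exact_mod_cast hn
    have h := choose_mul_pow_le_exp (N := n - M.card) (j := k - M.card) (n := n)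
      (a := 1 - (1 - t / n) ^ k) (by exact_mod_cast Nat.sub_le _ _) hn' (by omega)
      (by linarith) (by linarith)
    rw [show n - M.card - (k - M.card) = n - k by omega, sub_sub_cancel,
      Nat.cast_sub hMk, Nat.cast_sub (hMk.trans hkn)] at h
    exact (weightLaw_card_reached_le h0 h1 M hMk).trans h
  · have : {w | (reached (graph n t w) M).card = k} = ∅ := by
      refine Set.eq_empty_iff_forall_notMem.2 fun w hw => hk ?_
      have hw : (reached (graph n t w) M).card = k := hw
      have hle := Finset.card_le_univ (reached (graph n t w) M)
      rw [Fintype.card_fin] at hle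
      exact ⟨hw ▸ Finset.card_le_card (subset_reached M), hw ▸ hle⟩
    rw [this, measureReal_empty]
    positivity

/-- Uniform in `M` because seeds only help: the distance `-D` below the mean equals `n * (1 - q^k) -
k + M.card * q^k` with `q = 1 - t/n`, which is at least `n * drift t (k/n)`. -/
theorem weightLaw_card_reached_window_le {δ : ℝ} (hn : 1 ≤ n) (h0 : 0 ≤ t / n) (h1 : t / n ≤ 1)
    (hδ0 : 0 < δ) (hδ : 0 < drift t δ) (M : Finset (Fin n)) {k : ℕ}
    (hk : δ / 2 * n ≤ k) (hk' : k ≤ δ * n) :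
    (weightLaw n).real {w | (reached (graph n t w) M).card = k} ≤
      Real.exp (-((drift t δ / 2) ^ 2 * n / 4)) := by
  have hn' : (0 : ℝ) < n := by exact_mod_cast hn
  refine (weightLaw_card_reached_le_exp hn h0 h1 M k).trans (Real.exp_le_exp.2 (neg_le_neg ?_))
  have hf := half_drift_le hδ0 hδ ((le_div_iff₀ hn').2 hk) ((div_le_iff₀ hn').2 hk')
  have hq := one_sub_pow_le_exp h1 k
  have hq0 : 0 ≤ (1 - t / n) ^ k := pow_nonneg (by linarith) k
  have hnf : n * drift t (k / n) = n * (1 - Real.exp (-(t * (k / n)))) - k := by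
    simp only [drift]; field_simp
  have hM : (0 : ℝ) ≤ M.card := Nat.cast_nonneg _
  set D : ℝ := (k - M.card : ℝ) - (n - M.card) * (1 - (1 - t / n) ^ k) with hD
  have hDle : n * (drift t δ / 2) ≤ -D := by
    have e1 := mul_le_mul_of_nonneg_left hf hn'.le
    have e2 := mul_le_mul_of_nonneg_left hq hn'.le
    have e3 := mul_nonneg hM hq0
    rw [hD]
    linarith
  have hsq : (n * (drift t δ / 2)) ^ 2 ≤ D ^ 2 := by
    rw [← neg_sq D]
    exact pow_le_pow_left₀ (by positivity) hDle 2
  rw [le_div_iff₀ (by positivity)]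
  linarith

theorem weightLaw_card_component_le {δ Δ : ℝ} (hn : 1 ≤ n) (ht : 1 < t) (h1 : t / n ≤ 1 / 2)
    (hδ0 : 0 < δ) (hδ : 0 < drift t δ) (v : Fin n) {k : ℕ} (hkn : k ≤ n)
    (hk : δ / 2 * n ≤ k) (hΔ : Δ ≤ |k - n * rho t|)
    (hΔ' : 1 + 2 * t ^ 2 ≤ drift t δ / 2 * Δ) :
    (weightLaw n).real {w | (reached (graph n t w) {v}).card = k} ≤
      Real.exp (-((drift t δ / 2 * Δ - (1 + 2 * t ^ 2)) ^ 2 / (4 * n))) := by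
  have hn' : (0 : ℝ) < n := by exact_mod_cast hn
  have h0 : 0 ≤ t / n := by positivity
  refine (weightLaw_card_reached_le_exp hn h0 (by linarith) {v} k).trans
    (Real.exp_le_exp.2 (neg_le_neg ?_))
  have hf := mul_abs_sub_rho_le ht hδ0 hδ ((le_div_iff₀ hn').2 hk)
  have hq := one_sub_pow_le_exp (by linarith : t / n ≤ 1) k
  have hq' := exp_le_one_sub_pow_add hn (by linarith) h1 hkn
  have hq0 : 0 ≤ (1 - t / n) ^ k := pow_nonneg (by linarith) k
  have hq1 : (1 - t / n) ^ k ≤ 1 := pow_le_one₀ (by linarith) (by linarith)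
  have hnf : n * drift t (k / n) = n * (1 - Real.exp (-(t * (k / n)))) - k := by
    simp only [drift]; field_simp
  rw [Finset.card_singleton, Nat.cast_one]
  set D : ℝ := (k - 1 : ℝ) - (n - 1) * (1 - (1 - t / n) ^ k) with hD
  have hfn : drift t δ / 2 * |k - n * rho t| ≤ |n * drift t (k / n)| := by
    rw [abs_mul, abs_of_pos hn']
    refine le_trans (le_of_eq ?_) (mul_le_mul_of_nonneg_left hf hn'.le)
    rw [show (k : ℝ) - n * rho t = n * (k / n - rho t) by field_simp, abs_mul, abs_of_pos hn']
    ring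
  -- The `1` pays for the single seed, the `2 * t ^ 2` for replacing the power by the exponential.
  have hDf : |n * drift t (k / n) + D| ≤ 1 + 2 * t ^ 2 := by
    have e1 := mul_le_mul_of_nonneg_left hq hn'.le
    have e2 := mul_le_mul_of_nonneg_left hq' hn'.le
    have e3 : (n : ℝ) * ((1 - t / n) ^ k + 2 * t ^ 2 / n) = n * (1 - t / n) ^ k + 2 * t ^ 2 := by
      field_simp
    rw [e3] at e2
    rw [hnf, hD, abs_le]
    constructor <;> nlinarith
  have hDabs : drift t δ / 2 * Δ - (1 + 2 * t ^ 2) ≤ |D| := by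
    have e1 : |n * drift t (k / n)| ≤ |n * drift t (k / n) + D| + |D| := by
      simpa using abs_sub (n * drift t (k / n) + D) D
    have e2 := mul_le_mul_of_nonneg_left hΔ (by positivity : 0 ≤ drift t δ / 2)
    linarith
  have hsq : (drift t δ / 2 * Δ - (1 + 2 * t ^ 2)) ^ 2 ≤ D ^ 2 := by
    rw [← sq_abs D]
    exact pow_le_pow_left₀ (by linarith) hDabs 2
  gcongr

end Tail

/-! ### A large component from a jump over the window. -/

section Deterministic

variable {n : ℕ} (G : SimpleGraph (Fin n))

/-- The first `i` vertices. -/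
def firstVertices (n i : ℕ) : Finset (Fin n) := Finset.univ.filter fun x => x.val < i

theorem mem_firstVertices {i : ℕ} {x : Fin n} : x ∈ firstVertices n i ↔ x.val < i := by
  simp [firstVertices]

/-- If the components of the first `i` vertices never have total size in `[a, b]`, then there is a
component of size at least `b - a`. -/
theorem exists_card_component_ge {a b : ℝ} (hb : b < n) (hb0 : 0 ≤ b)
    (h : ∀ i ≤ n, ¬ (a ≤ (reached G (firstVertices n i)).card ∧
      (reached G (firstVertices n i)).card ≤ b)) :
    ∃ v, b - a ≤ (reached G {v}).card := by
  classical
  have hex : ∃ i, b < (reached G (firstVertices n i)).card := by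
    refine ⟨n, hb.trans_le ?_⟩
    have : firstVertices n n = Finset.univ := by
      ext x; simp [firstVertices]
    rw [this]
    have := Finset.card_le_card (subset_reached (G := G) Finset.univ)
    rw [Finset.card_univ, Fintype.card_fin] at this
    exact_mod_cast this
  -- Take the first index at which the total exceeds `b`. Just before, the total is at most `b`,
  -- hence below `a`, so the last added vertex contributes more than `b - a`.
  have hspec := Nat.find_spec hex
  have hmin := fun m => Nat.find_min hex (m := m)
  have hle : Nat.find hex ≤ n := by
    by_contra! hlt
    apply hmin n hlt
    have : firstVertices n (Nat.find hex) = firstVertices n n := by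
      ext x
      exact iff_of_true (mem_firstVertices.2 (x.isLt.trans hlt)) (mem_firstVertices.2 x.isLt)
    rwa [this] at hspec
  generalize Nat.find hex = i at hspec hmin hle
  rcases i with _ | i
  · exfalso
    have : reached G (firstVertices n 0) = ∅ := by
      ext x; simp [mem_reached, firstVertices]
    rw [this] at hspec
    simp at hspec
    linarith
  · refine ⟨⟨i, hle⟩, ?_⟩
    have hstep : firstVertices n (i + 1) = firstVertices n i ∪ {⟨i, hle⟩} := by
      ext x
      simp only [firstVertices, Finset.mem_filter, Finset.mem_univ, true_and, Finset.mem_union,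
        Finset.mem_singleton, Fin.ext_iff]
      omega
    have hprev := hmin i (Nat.lt_succ_self i)
    rw [not_lt] at hprev
    have hlt : ((reached G (firstVertices n i)).card : ℝ) < a := by
      by_contra! hcon
      exact h i (by omega) ⟨hcon, hprev⟩
    rw [hstep, reached_union] at hspec
    have hcard : ((reached G (firstVertices n i) ∪ reached G {⟨i, hle⟩}).card : ℝ) ≤
        (reached G (firstVertices n i)).card + (reached G {⟨i, hle⟩}).card := by
      exact_mod_cast Finset.card_union_le _ _
    linarith

theorem card_component_le_largestComponent (v : Fin n) :
    (reached G {v}).card ≤ largestComponent G := by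
  rw [card_reached_singleton, largestComponent]
  exact Finset.le_sup (f := fun x : Fin n => (G.connectedComponentMk x).supp.ncard)
    (Finset.mem_univ v)

theorem exists_card_component_eq_largestComponent (hn : 1 ≤ n) :
    ∃ v, (reached G {v}).card = largestComponent G := by
  have : Nonempty (Fin n) := ⟨⟨0, hn⟩⟩
  obtain ⟨v, -, hv⟩ := Finset.exists_mem_eq_sup Finset.univ Finset.univ_nonempty
    fun x : Fin n => (G.connectedComponentMk x).supp.ncard
  exact ⟨v, by rw [card_reached_singleton, largestComponent, hv]⟩

end Deterministic

/-! ### Union bound and choice of constants. -/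

/-- Gaussian-type tail bound for the size of the giant component. -/
theorem weightLaw_L_deviation_le {n : ℕ} {t δ Δ : ℝ} (hn : 1 ≤ n) (ht : 1 < t)
    (h1 : t / n ≤ 1 / 2) (hδ0 : 0 < δ) (hδ1 : δ < 1) (hδ : 0 < drift t δ)
    (hΔ' : 1 + 2 * t ^ 2 ≤ drift t δ / 2 * Δ) :
    (weightLaw n).real {w | Δ < |(L n t w : ℝ) - n * rho t|} ≤
      (n + 1) ^ 2 * (Real.exp (-((drift t δ / 2) ^ 2 * n / 4)) +
        Real.exp (-((drift t δ / 2 * Δ - (1 + 2 * t ^ 2)) ^ 2 / (4 * n)))) := by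
  classical
  have hn' : (0 : ℝ) < n := by exact_mod_cast hn
  have h0 : 0 ≤ t / n := by positivity
  let K₁ : Finset ℕ := (Finset.range (n + 1)).filter fun k => δ / 2 * n ≤ (k : ℝ) ∧ (k : ℝ) ≤ δ * n
  let K₂ : Finset ℕ := (Finset.range (n + 1)).filter fun k =>
    δ / 2 * n ≤ (k : ℝ) ∧ Δ < |(k : ℝ) - n * rho t|
  let E (M : Finset (Fin n)) (k : ℕ) : Set (Sym2 (Fin n) → ℝ) :=
    {w | (reached (graph n t w) M).card = k}
  let A : Set (Sym2 (Fin n) → ℝ) :=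
    ⋃ z ∈ Finset.range (n + 1) ×ˢ K₁, E (firstVertices n z.1) z.2
  let B : Set (Sym2 (Fin n) → ℝ) := ⋃ z ∈ (Finset.univ : Finset (Fin n)) ×ˢ K₂, E {z.1} z.2
  have hrange : ∀ (w : Sym2 (Fin n) → ℝ) (M : Finset (Fin n)),
      (reached (graph n t w) M).card ∈ Finset.range (n + 1) := fun w M => by
    have := Finset.card_le_univ (reached (graph n t w) M)
    rw [Fintype.card_fin] at this
    exact Finset.mem_range.2 (by omega)
  -- Off `A` no prefix total meets the window, so some component, and thus the largest, has at least
  -- `δn - δn/2` vertices; a deviation above `Δ` then places it in `B`.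
  have hcover : {w | Δ < |(L n t w : ℝ) - n * rho t|} ⊆ A ∪ B := by
    intro w hw
    have hw : Δ < |(L n t w : ℝ) - n * rho t| := hw
    by_contra hAB
    rw [Set.mem_union, not_or] at hAB
    obtain ⟨u, hu⟩ := exists_card_component_ge (graph n t w) (a := δ / 2 * n) (b := δ * n)
      (by nlinarith) (by positivity) fun i hi hwin => hAB.1 <|
        Set.mem_biUnion (x := (i, (reached (graph n t w) (firstVertices n i)).card))
          (Finset.mem_coe.2 (Finset.mem_product.2 ⟨Finset.mem_range.2 (by omega),
            Finset.mem_filter.2 ⟨hrange w _, hwin⟩⟩)) rfl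
    obtain ⟨v, hv⟩ := exists_card_component_eq_largestComponent (graph n t w) hn
    have hLv : (L n t w : ℝ) = (reached (graph n t w) {v}).card := by rw [hv]; rfl
    have huv : ((reached (graph n t w) {u}).card : ℝ) ≤ (reached (graph n t w) {v}).card := by
      exact_mod_cast hv ▸ card_component_le_largestComponent (graph n t w) u
    exact hAB.2 <| Set.mem_biUnion (x := (v, (reached (graph n t w) {v}).card))
      (Finset.mem_coe.2 (Finset.mem_product.2 ⟨Finset.mem_univ _,
        Finset.mem_filter.2 ⟨hrange w _, by linarith, hLv ▸ hw⟩⟩)) rfl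
  have hA : (weightLaw n).real A ≤ (n + 1) ^ 2 * Real.exp (-((drift t δ / 2) ^ 2 * n / 4)) := by
    refine (measureReal_biUnion_finset_le _ _).trans ?_
    refine (Finset.sum_le_card_nsmul _ _ (Real.exp (-((drift t δ / 2) ^ 2 * n / 4)))
      fun z hz => ?_).trans ?_
    · obtain ⟨-, hz⟩ := Finset.mem_product.1 hz
      obtain ⟨-, hz, hz'⟩ := Finset.mem_filter.1 hz
      exact weightLaw_card_reached_window_le hn h0 (by linarith) hδ0 hδ _ hz hz'
    · rw [nsmul_eq_mul]
      gcongr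
      have hK : K₁.card ≤ n + 1 := (Finset.card_filter_le _ _).trans (by simp)
      rw [Finset.card_product, Finset.card_range, pow_two]
      exact_mod_cast Nat.mul_le_mul_left _ hK
  have hB : (weightLaw n).real B ≤ (n + 1) ^ 2 *
      Real.exp (-((drift t δ / 2 * Δ - (1 + 2 * t ^ 2)) ^ 2 / (4 * n))) := by
    refine (measureReal_biUnion_finset_le _ _).trans ?_
    refine (Finset.sum_le_card_nsmul _ _
      (Real.exp (-((drift t δ / 2 * Δ - (1 + 2 * t ^ 2)) ^ 2 / (4 * n)))) fun z hz => ?_).trans ?_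
    · obtain ⟨-, hz⟩ := Finset.mem_product.1 hz
      obtain ⟨hzn, hz, hz'⟩ := Finset.mem_filter.1 hz
      exact weightLaw_card_component_le hn ht h1 hδ0 hδ _
        (Nat.lt_succ_iff.1 (Finset.mem_range.1 hzn)) hz hz'.le hΔ'
    · rw [nsmul_eq_mul]
      gcongr
      have hK : K₂.card ≤ n + 1 := (Finset.card_filter_le _ _).trans (by simp)
      rw [Finset.card_product, Finset.card_univ, Fintype.card_fin, pow_two]
      exact_mod_cast Nat.mul_le_mul (Nat.le_succ n) hK
  calc _ ≤ (weightLaw n).real (A ∪ B) := measureReal_mono hcover (measure_ne_top _ _)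
    _ ≤ (weightLaw n).real A + (weightLaw n).real B := measureReal_union_le _ _
    _ ≤ _ := by rw [mul_add]; exact add_le_add hA hB

theorem lt_abs_X_iff {n : ℕ} (hn : 1 ≤ n) {t a : ℝ} {w : Sym2 (Fin n) → ℝ} :
    a < |X n t w| ↔ √(n : ℝ) * a < |(L n t w : ℝ) - n * rho t| := by
  have hs : 0 < √(n : ℝ) := Real.sqrt_pos.2 (by exact_mod_cast hn)
  rw [X, abs_mul, abs_of_pos (by positivity), one_div, ← div_eq_inv_mul, lt_div_iff₀ hs, mul_comm]

theorem tendsto_sq_mul_exp_neg_rpow {γ b : ℝ} (hγ : 0 < γ) (hb : 0 < b) :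
    Filter.Tendsto (fun n : ℕ => (n : ℝ) ^ 2 * Real.exp (-(b * (n : ℝ) ^ (2 * γ))))
      Filter.atTop (nhds 0) := by
  have h := (tendsto_rpow_mul_exp_neg_mul_atTop_nhds_zero (1 / γ) b hb).comp
    ((tendsto_rpow_atTop (by linarith : 0 < 2 * γ)).comp tendsto_natCast_atTop_atTop)
  refine h.congr fun n => ?_
  simp only [Function.comp_apply]
  rw [← Real.rpow_mul (Nat.cast_nonneg n), show 2 * γ * (1 / γ) = (2 : ℕ) by field_simp; norm_num,
    Real.rpow_natCast, neg_mul]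

end RandomGraphFlow

theorem lemma6 (t₀ t₁ γ : ℝ) (ht₀ : 1 < t₀) (ht : t₀ < t₁) (hγ₀ : 0 < γ) (hγ₁ : γ < 1 / 2) :
    ∃ C C' : ℝ, 0 < C ∧ 0 < C' ∧ ∀ n : ℕ, 1 ≤ n → ∀ t ∈ Set.Icc t₀ t₁,
      (RandomGraphFlow.weightLaw n).real {w | (n : ℝ) ^ γ < |RandomGraphFlow.X n t w|} ≤
        C' * Real.exp (-(C * (n : ℝ) ^ (2 * γ))) := by
  open RandomGraphFlow in
  obtain ⟨δ, hδ0, hδ1, hδ⟩ := exists_drift_pos ht₀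
  set η : ℝ := drift t₀ δ / 2 with hη
  have hη0 : 0 < η := by positivity
  set b : ℝ := 1 + 2 * t₁ ^ 2 with hb
  have hb0 : 0 < b := by positivity
  -- Chosen so that `2 * C * g ^ 2 = (η * Δ / 2) ^ 2 / (4 * n)` for `g = n ^ γ` and `Δ = √n * g`.
  -- One factor `exp (-(C * g ^ 2))` is spent on the polynomial prefactor.
  set C : ℝ := η ^ 2 / 32 with hC
  have hC0 : 0 < C := by positivity
  -- The threshold `1 / 8` matches `2 * (n + 1) ^ 2 ≤ 8 * n ^ 2`.
  have hsmall : ∀ᶠ n : ℕ in Filter.atTop,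
      (n : ℝ) ^ 2 * Real.exp (-(C * (n : ℝ) ^ (2 * γ))) < 1 / 8 :=
    (tendsto_sq_mul_exp_neg_rpow hγ₀ hC0).eventually_lt_const (by norm_num)
  have hlarge : ∀ᶠ n : ℕ in Filter.atTop, 2 * t₁ ≤ (n : ℝ) :=
    tendsto_natCast_atTop_atTop.eventually_ge_atTop _
  -- Ensures `b ≤ η * Δ / 2`, so the correction `1 + 2 * t ^ 2` costs at most half of `η * Δ`.
  have hsqrt : ∀ᶠ n : ℕ in Filter.atTop, 2 * b / η ≤ √(n : ℝ) :=
    (Real.tendsto_sqrt_atTop.comp tendsto_natCast_atTop_atTop).eventually_ge_atTop _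
  obtain ⟨n₀, hn₀⟩ := Filter.eventually_atTop.1 (hsmall.and (hlarge.and hsqrt))
  -- The second constant makes the right side at least `1` for `n < n₀`.
  refine ⟨C, Real.exp (C * (n₀ : ℝ) ^ (2 * γ)), hC0, Real.exp_pos _, fun n hn t htt => ?_⟩
  have hn1 : (1 : ℝ) ≤ n := by exact_mod_cast hn
  have hn' : (0 : ℝ) < n := by linarith
  rcases lt_or_ge n n₀ with hlt | hge
  · refine measureReal_le_one.trans ?_
    rw [← Real.exp_add]
    refine Real.one_le_exp ?_
    have : (n : ℝ) ^ (2 * γ) ≤ (n₀ : ℝ) ^ (2 * γ) := by gcongr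
    nlinarith
  obtain ⟨hs, hl, hq⟩ := hn₀ n hge
  have ht1 : 1 < t := ht₀.trans_le htt.1
  have hdt : η ≤ drift t δ / 2 := by linarith [drift_mono htt.1 hδ0.le]
  set g : ℝ := (n : ℝ) ^ γ with hg
  have hg1 : 1 ≤ g := Real.one_le_rpow hn1 hγ₀.le
  have hgg : (n : ℝ) ^ (2 * γ) = g ^ 2 := by
    rw [hg, ← Real.rpow_natCast, ← Real.rpow_mul hn'.le]
    congr 1
    push_cast
    ring
  -- Here `γ < 1 / 2` enters: the window estimate decays exponentially in `n`, which is at least `n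
  -- ^ (2 * γ)`.
  have hgn : g ^ 2 ≤ n := by
    rw [← hgg]
    calc (n : ℝ) ^ (2 * γ) ≤ (n : ℝ) ^ (1 : ℝ) := Real.rpow_le_rpow_of_exponent_le hn1 (by linarith)
      _ = n := Real.rpow_one _
  set Δ : ℝ := √(n : ℝ) * g with hΔ
  have hs0 : 0 ≤ √(n : ℝ) := Real.sqrt_nonneg _
  have hΔs : √(n : ℝ) ≤ Δ := le_mul_of_one_le_right hs0 hg1
  have hΔ0 : 0 ≤ Δ := hs0.trans hΔs
  have hΔsq : Δ ^ 2 = n * g ^ 2 := by rw [hΔ, mul_pow, Real.sq_sqrt hn'.le]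
  have hbΔ : 2 * b ≤ η * Δ := by
    rw [div_le_iff₀ hη0] at hq
    nlinarith
  have hηΔ : η * Δ ≤ drift t δ / 2 * Δ := by gcongr
  have hbt : 1 + 2 * t ^ 2 ≤ b := by
    have : t ^ 2 ≤ t₁ ^ 2 := pow_le_pow_left₀ (by linarith) htt.2 2
    linarith
  have hev : {w | g < |X n t w|} = {w | Δ < |(L n t w : ℝ) - n * rho t|} :=
    Set.ext fun w => lt_abs_X_iff hn
  rw [hev, hgg]
  rw [hgg] at hs
  have hmain := weightLaw_L_deviation_le (Δ := Δ) hn ht1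
    (by rw [div_le_iff₀ hn']; linarith [htt.2]) hδ0 hδ1 (by linarith) (by linarith)
  have hfirst : Real.exp (-((drift t δ / 2) ^ 2 * n / 4)) ≤ Real.exp (-(2 * C * g ^ 2)) := by
    refine Real.exp_le_exp.2 (neg_le_neg ?_)
    have e1 : η ^ 2 * g ^ 2 ≤ (drift t δ / 2) ^ 2 * n := by gcongr
    have e2 : 0 ≤ η ^ 2 * g ^ 2 := by positivity
    rw [hC]
    linarith
  have hsecond : Real.exp (-((drift t δ / 2 * Δ - (1 + 2 * t ^ 2)) ^ 2 / (4 * n))) ≤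
      Real.exp (-(2 * C * g ^ 2)) := by
    refine Real.exp_le_exp.2 (neg_le_neg ?_)
    rw [le_div_iff₀ (by positivity)]
    calc 2 * C * g ^ 2 * (4 * n) = (η * Δ / 2) ^ 2 := by
          rw [div_pow, mul_pow, hΔsq, hC]; ring
      _ ≤ _ := pow_le_pow_left₀ (by positivity) (by linarith) 2
  have hsplit : Real.exp (-(2 * C * g ^ 2)) =
      Real.exp (-(C * g ^ 2)) * Real.exp (-(C * g ^ 2)) := by
    rw [← Real.exp_add]; congr 1; ring
  have hpoly : ((n : ℝ) + 1) ^ 2 * 2 ≤ 8 * (n : ℝ) ^ 2 := by nlinarith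
  have hexp1 : 1 ≤ Real.exp (C * (n₀ : ℝ) ^ (2 * γ)) := Real.one_le_exp (by positivity)
  calc _ ≤ _ := hmain
    _ ≤ ((n : ℝ) + 1) ^ 2 * (Real.exp (-(2 * C * g ^ 2)) + Real.exp (-(2 * C * g ^ 2))) := by
        gcongr
    _ = ((n : ℝ) + 1) ^ 2 * 2 * Real.exp (-(C * g ^ 2)) * Real.exp (-(C * g ^ 2)) := by
        rw [hsplit]; ring
    _ ≤ 8 * (n : ℝ) ^ 2 * Real.exp (-(C * g ^ 2)) * Real.exp (-(C * g ^ 2)) := by gcongr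
    _ ≤ 1 * Real.exp (-(C * g ^ 2)) := by
        gcongr
        linarith
    _ ≤ _ := by gcongr
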